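/- Let $n,k$ be integers with $1\le k<n/2$. A \emph{simple allowable sequence} on $[n]=\{1,\dots,n\}$ is a doubly infinite sequence $\Pi=(\dots,\pi_{-1},\pi_0,\pi_1,\dots)$ of permutations of $[n]$ such that any two consecutive permutations $\pi_j,\pi_{j+1}$ differ by a transposition of the elements in two neighboring positions, and such that $\pi_{j+\binom n2}$ is the reverse of $\pi_j$ for every $j$. A \emph{halfperiod} of $\Pi$ is a sequence of $\binom n2+1$ consecutive permutations of $\Pi$. A transposition of the elements in positions $i$ and $i+1$ is called an $i$-transposition; for $1\le m\le n/2$, the $m$-transpositions and the $(n-m)$-transpositions are called $m$-critical. Let $E_{j}(\Pi)$ be the number of $(j+1)$-critical transpositions in a halfperiod of $\Pi$, and let $E_{\ge j}(\Pi)$ be the number of transpositions in a halfperiod of $\Pi$ that are $m$-critical for some $m\ge j+1$; neither number depends on the choice of the halfperiod. For a permutation $\sigma$ of $[n]$, let $C(k,\sigma)$ (the \emph{$k$-center} of $\sigma$) be the set of elements in the middle $n-2k$ positions of $\sigma$. For a halfperiod $\pi=(\pi_0,\pi_1,\dots,\pi_{\binom n2})$, reindexed to start at $0$, put $C_0=C(k,\pi_0)$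 and $$s(k,\pi)=\min\Bigl\{\,|C_0\cap C(k,\pi_i)| : 0\le i\le \tbinom n2\Bigr\}.$$ \textbf{Theorem.} Let $\Pi$ be a simple allowable sequence on $[n]$, let $\pi$ be any halfperiod of $\Pi$, and let $s=s(k,\pi)$. Then $$E_{\ge k}(\Pi)\le (n-2k-1)\,E_{k-1}(\Pi)-\frac s2\bigl(E_{k-1}(\Pi)-n+1\bigr).$$ -/

import Mathlib

/-- A simple allowable sequence on `[n]`: a doubly infinite sequence of permutations of `[n]`
(`perm j p` is the element in position `p` of the `j`-th permutation) such that consecutive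
permutations differ by a transposition of the elements in two neighboring positions, and the
permutation `n.choose 2` steps later is always the reverse permutation.
Positions are indexed by `Fin n`, so the `i`-th position (counted from 1) is `i - 1 : Fin n`. -/
structure SimpleAllowableSequence (n : ℕ) where
  perm : ℤ → Equiv.Perm (Fin n)
  step : ∀ j : ℤ, ∃ (i : ℕ) (h : i + 1 < n),
    perm (j + 1) = perm j * Equiv.swap ⟨i, Nat.lt_of_succ_lt h⟩ ⟨i + 1, h⟩
  reverse : ∀ j : ℤ, perm (j + (n.choose 2 : ℤ)) = perm j * Fin.revPerm

namespace AllowableSequence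

/-- A sequence of `n.choose 2 + 1` permutations of `[n]`. -/
abbrev PermSeq (n : ℕ) : Type := Fin (n.choose 2 + 1) → Equiv.Perm (Fin n)

/-- `π` consists of `n.choose 2 + 1` consecutive permutations of `Π`. -/
def IsHalfperiod {n : ℕ} (S : SimpleAllowableSequence n) (π : PermSeq n) : Prop :=
  ∃ a : ℤ, ∀ i, π i = S.perm (a + ((i : ℕ) : ℤ))

/-- The permutation `τ` arises from `σ` by transposing the elements in positions `i` and `i + 1`
(counted from 1): an `i`-transposition. -/
def IsTransposition {n : ℕ} (i : ℕ) (σ τ : Equiv.Perm (Fin n)) : Prop :=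
  ∃ (_ : 1 ≤ i) (h : i < n),
    τ = σ * Equiv.swap ⟨i - 1, lt_of_le_of_lt (Nat.sub_le i 1) h⟩ ⟨i, h⟩

/-- The `m`-critical transpositions, `1 ≤ m ≤ n / 2`: those that are `m`-transpositions or
`(n - m)`-transpositions. -/
def IsCritical {n : ℕ} (m : ℕ) (σ τ : Equiv.Perm (Fin n)) : Prop :=
  1 ≤ m ∧ 2 * m ≤ n ∧ (IsTransposition m σ τ ∨ IsTransposition (n - m) σ τ)

open Classical in
/-- The number of the transpositions in the sequence `π` that are `m`-critical for some `m`
satisfying `Q`. -/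
noncomputable def countCritical {n : ℕ} (Q : ℕ → Prop) (π : PermSeq n) : ℕ :=
  (Finset.univ.filter fun i : Fin (n.choose 2) =>
    ∃ m, Q m ∧ IsCritical m (π i.castSucc) (π i.succ)).card

/-- The halfperiod of `Π` that starts with the permutation of index `0`. -/
def baseHalfperiod {n : ℕ} (S : SimpleAllowableSequence n) : PermSeq n :=
  fun i => S.perm ((i : ℕ) : ℤ)

/-- `E_j(Π)`: the number of `(j + 1)`-critical transpositions in a halfperiod of `Π`
(in any halfperiod, by `numEdges_eq` below). -/
noncomputable def numEdges {n : ℕ} (j : ℕ) (S : SimpleAllowableSequence n) : ℕ :=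
  countCritical (fun m => m = j + 1) (baseHalfperiod S)

/-- `E_{≥ j}(Π)`: the number of `(≥ j + 1)`-critical transpositions in a halfperiod of `Π`
(in any halfperiod, by `numEdgesGE_eq` below). -/
noncomputable def numEdgesGE {n : ℕ} (j : ℕ) (S : SimpleAllowableSequence n) : ℕ :=
  countCritical (fun m => j + 1 ≤ m) (baseHalfperiod S)

/-- The `k`-center of a permutation `σ`: the set of the elements in the middle `n - 2k` positions,
that is, all positions except the first `k` and the last `k`. -/
def kCenter {n : ℕ} (k : ℕ) (σ : Equiv.Perm (Fin n)) : Finset (Fin n) :=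
  (Finset.univ.filter fun p : Fin n => k ≤ (p : ℕ) ∧ (p : ℕ) + k < n).image σ

/-- `s(k, π)`: the minimum over all `i` of the number of elements of the `k`-center `C₀` of `π 0`
that lie in the `k`-center of `π i`. -/
def minCenter {n : ℕ} (k : ℕ) (π : PermSeq n) : ℕ :=
  Finset.univ.inf' Finset.univ_nonempty fun i => (kCenter k (π 0) ∩ kCenter k (π i)).card

/-! The counts do not depend on the halfperiod. -/

theorem isTransposition_reverse {n i : ℕ} {σ τ : Equiv.Perm (Fin n)}
    (h : IsTransposition i σ τ) :
    IsTransposition (n - i) (σ * Fin.revPerm) (τ * Fin.revPerm) := by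
  obtain ⟨h1, h2, rfl⟩ := h
  refine ⟨by omega, by omega, ?_⟩
  rw [mul_assoc, mul_assoc]
  congr 1
  have key := Equiv.mul_swap_eq_swap_mul (Fin.revPerm : Equiv.Perm (Fin n))
    ⟨n - i - 1, by omega⟩ ⟨n - i, by omega⟩
  rw [key, Equiv.swap_comm]
  congr 2 <;> ext <;> simp [Fin.rev] <;> omega

theorem isCritical_reverse {n m : ℕ} {σ τ : Equiv.Perm (Fin n)} (h : IsCritical m σ τ) :
    IsCritical m (σ * Fin.revPerm) (τ * Fin.revPerm) := by
  obtain ⟨h1, h2, h | h⟩ := h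
  · exact ⟨h1, h2, Or.inr (isTransposition_reverse h)⟩
  · have := isTransposition_reverse h
    rw [show n - (n - m) = m by omega] at this
    exact ⟨h1, h2, Or.inl this⟩

theorem isCritical_reverse_iff {n m : ℕ} {σ τ : Equiv.Perm (Fin n)} :
    IsCritical m (σ * Fin.revPerm) (τ * Fin.revPerm) ↔ IsCritical m σ τ := by
  refine ⟨fun h => ?_, isCritical_reverse⟩
  have hr : (Fin.revPerm : Equiv.Perm (Fin n)) * Fin.revPerm = 1 := by
    ext x; simp
  simpa [mul_assoc, hr] using isCritical_reverse h

theorem sum_periodic (f : ℤ → ℕ) (N : ℕ) (hf : ∀ j : ℤ, f (j + N) = f j) (a : ℤ) :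
    ∑ i ∈ Finset.range N, f (a + i) = ∑ i ∈ Finset.range N, f i := by
  have step : ∀ b : ℤ, ∑ i ∈ Finset.range N, f (b + 1 + i) = ∑ i ∈ Finset.range N, f (b + i) := by
    intro b
    have h1 := Finset.sum_range_succ (fun i : ℕ => f (b + i)) N
    have h2 := Finset.sum_range_succ' (fun i : ℕ => f (b + i)) N
    rw [h1] at h2
    simp only [hf, Nat.cast_zero, add_zero] at h2
    rw [Nat.add_right_cancel h2]
    refine Finset.sum_congr rfl fun i _ => ?_
    congr 1
    push_cast
    ring
  induction a using Int.induction_on with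
  | zero => simp
  | succ i ih => rw [step, ih]
  | pred i ih => rw [← ih, ← step (-(i : ℤ) - 1), sub_add_cancel]

theorem countCritical_eq {n : ℕ} (Q : ℕ → Prop) (S : SimpleAllowableSequence n) {π : PermSeq n}
    (hπ : IsHalfperiod S π) : countCritical Q π = countCritical Q (baseHalfperiod S) := by
  classical
  obtain ⟨a, ha⟩ := hπ
  let f : ℤ → ℕ := fun j => if ∃ m, Q m ∧ IsCritical m (S.perm j) (S.perm (j + 1)) then 1 else 0
  have hf : ∀ j : ℤ, f (j + (n.choose 2 : ℕ)) = f j := by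
    intro j
    simp only [f]
    rw [add_right_comm, S.reverse, S.reverse]
    simp only [isCritical_reverse_iff]
  have h := sum_periodic f (n.choose 2) hf a
  rw [Finset.sum_range, Finset.sum_range] at h
  unfold countCritical
  rw [Finset.card_filter, Finset.card_filter]
  convert h using 2 with i _ i _
  · simp only [f, ha, Fin.val_castSucc, Fin.val_succ, Nat.cast_add, Nat.cast_one, add_assoc]
  · simp only [f, baseHalfperiod, Fin.val_castSucc, Fin.val_succ, Nat.cast_add, Nat.cast_one]

theorem numEdges_eq {n : ℕ} (j : ℕ) (S : SimpleAllowableSequence n) {π : PermSeq n}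
    (hπ : IsHalfperiod S π) : numEdges j S = countCritical (fun m => m = j + 1) π :=
  (countCritical_eq _ S hπ).symm

theorem numEdgesGE_eq {n : ℕ} (j : ℕ) (S : SimpleAllowableSequence n) {π : PermSeq n}
    (hπ : IsHalfperiod S π) : numEdgesGE j S = countCritical (fun m => j + 1 ≤ m) π :=
  (countCritical_eq _ S hπ).symm

end AllowableSequence

/-! Name each element by its initial position, and let `ρ t` give its position at time `t`. All
`n.choose 2` pairs must be reversed in `n.choose 2` exchanges, so every exchange reverses a pair
still in its initial order (`exchange_lt`). Call an exchange central if it takes place inside the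
middle, critical if it takes place at one of the two boundaries of the middle.

Every central exchange uses up a pair of `uncrossed`, and only critical exchanges can create such
pairs. A critical exchange brings one element into the middle, which forms at most `n - 2k - 1` new
pairs; this alone gives the leading term. The saving comes from pairs that both start in the middle,
as these were counted from the beginning. Let `c` be the size of `common`. A critical exchange that
leaves `moved` unchanged creates at most `n - 2k - 1 - c` pairs if it raises `c`, and at most `n -
2k - 1 - s` in any case. If `moved` grows, the full `n - 2k - 1` may occur, but the total growth of
`moved` is only `2k`. After a time at which `c = s`, the value of `c` must climb back to `n - 2k`,
and the extra savings `c - s` on the way add up to a binomial coefficient.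

This is packed into the potential `2 * uncrossed + (c - s)(c - s - 1) - 2s * moved`, with `c`
replaced by `s` before the minimum. It drops by at least 2 at a central exchange and rises by at
most `2(n - 2k - 1 - s)` at a critical one (`step_of_left`, `step_of_right`,
`invariant_of_noncritical`). Likewise `moved + c` rises by at most 1 at critical exchanges only,
from `s` to `n`, so at least `n - s` of them occur. Summation (`card_central_le`) and these two
bounds give the theorem. -/

namespace AllowableSequence

open Finset

/-! ### Statistics of a position function and their reflection symmetry -/

/-- The middle `n - 2k` positions. -/
def middle (n k : ℕ) : Finset (Fin n) :=
  univ.filter fun p : Fin n => k ≤ (p : ℕ) ∧ (p : ℕ) + k < n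

theorem mem_middle {n k : ℕ} {p : Fin n} :
    p ∈ middle n k ↔ k ≤ (p : ℕ) ∧ (p : ℕ) + k < n := by
  simp [middle]

theorem card_middle (n k : ℕ) : (middle n k).card = n - 2 * k := by
  have h : (middle n k).map Fin.valEmbedding = Ico k (n - k) := by
    ext x
    simp only [mem_map, mem_middle, Fin.valEmbedding_apply, mem_Ico]
    constructor
    · rintro ⟨a, h, rfl⟩
      omega
    · intro h
      exact ⟨⟨x, by omega⟩, by simp; omega, rfl⟩
  rw [← card_map Fin.valEmbedding, h, Nat.card_Ico]
  omega

/-- The pairs of elements in the same order under `ρ` as initially, which either both start in the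
middle or are both in the middle now; `ρ x` is the position of the element starting in `x`. -/
def uncrossed {n : ℕ} (k : ℕ) (ρ : Equiv.Perm (Fin n)) : Finset (Fin n × Fin n) :=
  univ.filter fun q => q.1 < q.2 ∧ ρ q.1 < ρ q.2 ∧
    ((q.1 ∈ middle n k ∧ q.2 ∈ middle n k) ∨ (ρ q.1 ∈ middle n k ∧ ρ q.2 ∈ middle n k))

/-- The elements that start in the middle and are in the middle under `ρ`. -/
def common {n : ℕ} (k : ℕ) (ρ : Equiv.Perm (Fin n)) : Finset (Fin n) :=
  (middle n k).filter fun x => ρ x ∈ middle n k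

/-- The elements among the first `k` that are not among the first `k` under `ρ`. -/
def movedLeft {n : ℕ} (k : ℕ) (ρ : Equiv.Perm (Fin n)) : Finset (Fin n) :=
  univ.filter fun x => (x : ℕ) < k ∧ k ≤ (ρ x : ℕ)

/-- The elements among the last `k` that are not among the last `k` under `ρ`. -/
def movedRight {n : ℕ} (k : ℕ) (ρ : Equiv.Perm (Fin n)) : Finset (Fin n) :=
  univ.filter fun x => n ≤ (x : ℕ) + k ∧ (ρ x : ℕ) + k < n

/-- The number of outer elements that have left the side on which they started. -/
def moved {n : ℕ} (k : ℕ) (ρ : Equiv.Perm (Fin n)) : ℕ :=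
  (movedLeft k ρ).card + (movedRight k ρ).card

/-- The position function seen from the other end. -/
def flip {n : ℕ} (ρ : Equiv.Perm (Fin n)) : Equiv.Perm (Fin n) :=
  Fin.revPerm * ρ * Fin.revPerm

theorem flip_apply {n : ℕ} (ρ : Equiv.Perm (Fin n)) (x : Fin n) :
    flip ρ x = (ρ x.rev).rev := rfl

theorem rev_mem_middle {n k : ℕ} {p : Fin n} : p.rev ∈ middle n k ↔ p ∈ middle n k := by
  simp only [mem_middle, Fin.val_rev]
  omega

theorem card_uncrossed_flip {n : ℕ} (k : ℕ) (ρ : Equiv.Perm (Fin n)) :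
    (uncrossed k (flip ρ)).card = (uncrossed k ρ).card := by
  refine card_bij' (fun q _ => (q.2.rev, q.1.rev)) (fun q _ => (q.2.rev, q.1.rev)) ?_ ?_
    (by simp) (by simp)
  all_goals
    rintro ⟨x, y⟩
    simp only [uncrossed, mem_filter, mem_univ, true_and, flip_apply, Fin.rev_lt_rev,
      rev_mem_middle, Fin.rev_rev]
    tauto

theorem card_common_flip {n : ℕ} (k : ℕ) (ρ : Equiv.Perm (Fin n)) :
    (common k (flip ρ)).card = (common k ρ).card := by
  refine card_bij' (fun q _ => q.rev) (fun q _ => q.rev) ?_ ?_ (by simp) (by simp)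
  all_goals
    intro x
    simp [common, flip_apply, rev_mem_middle]

theorem moved_flip {n : ℕ} (k : ℕ) (ρ : Equiv.Perm (Fin n)) :
    moved k (flip ρ) = moved k ρ := by
  have h : ∀ τ : Equiv.Perm (Fin n), (movedLeft k (flip τ)).card = (movedRight k τ).card := by
    intro τ
    refine card_bij' (fun q _ => q.rev) (fun q _ => q.rev) ?_ ?_ (by simp) (by simp)
    all_goals
      intro x
      have h1 := x.isLt
      have h2 := (τ x).isLt
      have h3 := (τ x.rev).isLt
      simp only [movedLeft, movedRight, mem_filter, mem_univ, true_and]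
      simp only [flip_apply, Fin.rev_rev, Fin.val_rev]
      omega
  have h2 : flip (flip ρ) = ρ := by
    ext x
    simp [flip_apply]
  have h3 := h (flip ρ)
  rw [h2] at h3
  rw [moved, moved, h, h3, add_comm]

/-! ### Exchanges of adjacent elements -/

/-- `τ` arises from `ρ` by exchanging the elements `a`, `b` in positions `p`, `p + 1`. -/
structure Exchange {n : ℕ} (p : ℕ) (ρ τ : Equiv.Perm (Fin n)) (a b : Fin n) : Prop where
  left : (ρ a : ℕ) = p
  right : (ρ b : ℕ) = p + 1
  left' : (τ a : ℕ) = p + 1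
  right' : (τ b : ℕ) = p
  rest : ∀ x, x ≠ a → x ≠ b → (ρ x : ℕ) ≠ p ∧ (ρ x : ℕ) ≠ p + 1 ∧ τ x = ρ x

theorem Exchange.ne {n p : ℕ} {ρ τ : Equiv.Perm (Fin n)} {a b : Fin n}
    (h : Exchange p ρ τ a b) : a ≠ b := by
  rintro rfl
  have h1 := h.left
  have h2 := h.right
  omega

theorem exists_exchange {n p : ℕ} (ρ : Equiv.Perm (Fin n)) (h : p + 1 < n) :
    ∃ a b : Fin n, Exchange p ρ
      (Equiv.swap (⟨p, Nat.lt_of_succ_lt h⟩ : Fin n) ⟨p + 1, h⟩ * ρ) a b := by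
  refine ⟨ρ.symm ⟨p, Nat.lt_of_succ_lt h⟩, ρ.symm ⟨p + 1, h⟩, by simp, by simp, by simp,
    by simp, ?_⟩
  intro x ha hb
  have h1 : ρ x ≠ ⟨p, Nat.lt_of_succ_lt h⟩ := fun e => ha (by rw [← e]; simp)
  have h2 : ρ x ≠ ⟨p + 1, h⟩ := fun e => hb (by rw [← e]; simp)
  refine ⟨fun e => h1 (Fin.ext e), fun e => h2 (Fin.ext e), ?_⟩
  rw [Equiv.Perm.mul_apply, Equiv.swap_apply_of_ne_of_ne h1 h2]

theorem Exchange.flip {n p : ℕ} {ρ τ : Equiv.Perm (Fin n)} {a b : Fin n}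
    (h : Exchange p ρ τ a b) : Exchange (n - 2 - p) (flip ρ) (flip τ) b.rev a.rev := by
  have h1 := h.left
  have h2 := h.right
  have h3 := h.left'
  have h4 := h.right'
  have h5 := (ρ b).isLt
  refine ⟨?_, ?_, ?_, ?_, fun x hb ha => ?_⟩
  iterate 4
    simp only [flip_apply, Fin.rev_rev, Fin.val_rev]
    omega
  obtain ⟨h6, h7, h8⟩ := h.rest x.rev (fun e => ha (by rw [← e, Fin.rev_rev]))
    (fun e => hb (by rw [← e, Fin.rev_rev]))
  simp only [flip_apply, Fin.val_rev, h8]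
  exact ⟨by omega, by omega, trivial⟩

/-! ### Effect of an exchange on the statistics -/

/-- The elements in the middle, except the one in the leftmost position of the middle. -/
def inner {n : ℕ} (k : ℕ) (ρ : Equiv.Perm (Fin n)) : Finset (Fin n) :=
  univ.filter fun z => k < (ρ z : ℕ) ∧ (ρ z : ℕ) + k < n

theorem card_inner {n k : ℕ} (ρ : Equiv.Perm (Fin n)) :
    (inner k ρ).card = n - 2 * k - 1 := by
  have h : (inner k ρ).map (ρ.toEmbedding.trans Fin.valEmbedding) = Ico (k + 1) (n - k) := by
    ext x
    simp only [mem_map, inner, mem_filter, mem_univ, true_and, Function.Embedding.trans_apply,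
      Fin.valEmbedding_apply, mem_Ico, Equiv.coe_toEmbedding]
    constructor
    · rintro ⟨a, h, rfl⟩
      omega
    · intro h
      exact ⟨ρ.symm ⟨x, by omega⟩, by simp; omega, by simp⟩
  rw [← card_map, h, Nat.card_Ico]
  omega

theorem common_eq_of_left {n k p : ℕ} (hkn : 2 * k < n) {ρ τ : Equiv.Perm (Fin n)} {a b : Fin n}
    (h : Exchange p ρ τ a b) (hp : p + 1 = k) :
    common k ρ = if b ∈ middle n k then insert b (inner k ρ ∩ middle n k)
      else inner k ρ ∩ middle n k := by
  ext x
  by_cases hxb : x = b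
  · subst hxb
    have := h.right
    split_ifs with hb <;> simp [common, hb]
    rw [mem_middle]
    omega
  · have : (ρ x : ℕ) ≠ k := by
      by_cases hxa : x = a
      · have := h.left
        subst hxa
        omega
      · have := (h.rest x hxa hxb).2.1
        omega
    have e : ρ x ∈ middle n k ↔ x ∈ inner k ρ := by
      simp only [mem_middle, inner, mem_filter, mem_univ, true_and]
      omega
    split_ifs <;> simp [common, hxb, e, and_comm]

theorem common_eq_of_left' {n k p : ℕ} (hkn : 2 * k < n) {ρ τ : Equiv.Perm (Fin n)} {a b : Fin n}
    (h : Exchange p ρ τ a b) (hp : p + 1 = k) :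
    common k τ = if a ∈ middle n k then insert a (inner k ρ ∩ middle n k)
      else inner k ρ ∩ middle n k := by
  have hl := h.left'
  have hr := h.right'
  have hl0 := h.left
  have hr0 := h.right
  ext x
  by_cases hxa : x = a
  · subst hxa
    split_ifs with hb <;> simp [common, hb]
    rw [mem_middle]
    omega
  · have e : τ x ∈ middle n k ↔ x ∈ inner k ρ := by
      simp only [mem_middle, inner, mem_filter, mem_univ, true_and]
      by_cases hxb : x = b
      · subst hxb
        omega
      · obtain ⟨h1, h2, h3⟩ := h.rest x hxa hxb
        rw [h3]
        omega
    split_ifs <;> simp [common, hxa, e, and_comm]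

theorem not_mem_inner {n k p : ℕ} {ρ τ : Equiv.Perm (Fin n)} {a b : Fin n}
    (h : Exchange p ρ τ a b) (hp : p + 1 = k) : a ∉ inner k ρ ∧ b ∉ inner k ρ := by
  have hl0 := h.left
  have hr0 := h.right
  simp only [inner, mem_filter, mem_univ, true_and]
  omega

/-- The exchange replaces only the occupant of the leftmost middle position, `b` by `a`; the rest of
the middle, `inner k ρ`, is the same before and after. -/
theorem card_common_of_left {n k p : ℕ} (hkn : 2 * k < n) {ρ τ : Equiv.Perm (Fin n)} {a b : Fin n}
    (h : Exchange p ρ τ a b) (hp : p + 1 = k) :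
    (common k ρ).card = (inner k ρ ∩ middle n k).card + (if b ∈ middle n k then 1 else 0) ∧
    (common k τ).card = (inner k ρ ∩ middle n k).card + (if a ∈ middle n k then 1 else 0) := by
  have := not_mem_inner h hp
  rw [common_eq_of_left hkn h hp, common_eq_of_left' hkn h hp]
  constructor
  all_goals
    split_ifs
    · rw [card_insert_of_notMem]
      simp [this]
    · rfl

/-- Here `a` leaves the first `k` positions and `b` enters them. Since `2 * k < n`, both positions
involved lie outside the last `k`, so `movedRight` is unaffected. -/
theorem moved_of_left {n k p : ℕ} (hkn : 2 * k < n) {ρ τ : Equiv.Perm (Fin n)} {a b : Fin n}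
    (h : Exchange p ρ τ a b) (hp : p + 1 = k) :
    moved k τ + (if (b : ℕ) < k then 1 else 0) = moved k ρ + (if (a : ℕ) < k then 1 else 0) := by
  have hl := h.left'
  have hr := h.right'
  have hl0 := h.left
  have hr0 := h.right
  have hR : movedRight k τ = movedRight k ρ := by
    ext x
    simp only [movedRight, mem_filter, mem_univ, true_and]
    by_cases hxa : x = a
    · subst hxa
      omega
    · by_cases hxb : x = b
      · subst hxb
        omega
      · rw [(h.rest x hxa hxb).2.2]
  have hL : (if (b : ℕ) < k then insert b (movedLeft k τ) else movedLeft k τ) =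
      (if (a : ℕ) < k then insert a (movedLeft k ρ) else movedLeft k ρ) := by
    ext x
    by_cases hxa : x = a
    · subst hxa
      have := h.ne
      split_ifs <;> simp [movedLeft, *]
    · by_cases hxb : x = b
      · subst hxb
        split_ifs <;> simp [movedLeft, *]
      · obtain ⟨h1, h2, h3⟩ := h.rest x hxa hxb
        split_ifs <;> simp [movedLeft, *]
  have hbn : b ∉ movedLeft k τ := by
    simp only [movedLeft, mem_filter, mem_univ, true_and]
    omega
  have han : a ∉ movedLeft k ρ := by
    simp only [movedLeft, mem_filter, mem_univ, true_and]
    omega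
  have hc := congrArg card hL
  rw [moved, moved, hR]
  have hb := card_insert_of_notMem hbn
  have ha := card_insert_of_notMem han
  split_ifs at hc ⊢ <;> omega

/-- Only `a` enters the middle and only `b` leaves it. New pairs can only be `(a, z)` with `z` to
the right of `a` in the middle, since a pair `(z, a)` with such `z` is out of order. Lost are the
pairs `(b, z)` that were counted only for being in the middle now, and `(a, b)` if it was counted.
-/
theorem card_uncrossed_of_left {n k p : ℕ} (hkn : 2 * k < n) {ρ τ : Equiv.Perm (Fin n)}
    {a b : Fin n} (h : Exchange p ρ τ a b) (hp : p + 1 = k) (hab : a < b) :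
    (uncrossed k τ).card +
      ((inner k ρ).filter fun z => b < z ∧ ¬(b ∈ middle n k ∧ z ∈ middle n k)).card +
      (if a ∈ middle n k ∧ b ∈ middle n k then 1 else 0) ≤
    (uncrossed k ρ).card +
      ((inner k ρ).filter fun z => a < z ∧ ¬(a ∈ middle n k ∧ z ∈ middle n k)).card := by
  have hl := h.left'
  have hr := h.right'
  have hl0 := h.left
  have hr0 := h.right
  set U := (inner k ρ).filter fun z => a < z ∧ ¬(a ∈ middle n k ∧ z ∈ middle n k) with hU
  set V := (inner k ρ).filter fun z => b < z ∧ ¬(b ∈ middle n k ∧ z ∈ middle n k) with hV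
  have h1 : (V.image fun z => (b, z)).card = V.card :=
    card_image_of_injective _ fun x y e => by simpa using e
  have h2 : (U.image fun z => (a, z)).card ≤ U.card := card_image_le
  have h3 : (({(a, b)} : Finset (Fin n × Fin n)).filter
      fun _ => a ∈ middle n k ∧ b ∈ middle n k).card =
      (if a ∈ middle n k ∧ b ∈ middle n k then 1 else 0) := by
    split_ifs with h <;> simp [h]
  have hd : Disjoint (uncrossed k τ ∪ V.image fun z => (b, z))
      (({(a, b)} : Finset (Fin n × Fin n)).filter
      fun _ => a ∈ middle n k ∧ b ∈ middle n k) := by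
    rw [disjoint_left]
    rintro ⟨x, y⟩ hx hy
    simp only [mem_filter, mem_singleton, Prod.mk.injEq] at hy
    obtain ⟨⟨rfl, rfl⟩, -⟩ := hy
    simp only [mem_union, uncrossed, mem_filter, mem_univ, true_and, Fin.lt_def, mem_image,
      Prod.mk.injEq] at hx
    rcases hx with hx | ⟨z, -, hz, -⟩
    · omega
    · exact h.ne hz.symm
  have hd' : Disjoint (uncrossed k τ) (V.image fun z => (b, z)) := by
    rw [disjoint_left]
    rintro ⟨x, y⟩ hx hy
    simp only [mem_image, Prod.mk.injEq] at hy
    obtain ⟨z, hz, rfl, rfl⟩ := hy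
    simp only [hV, inner, mem_filter, mem_univ, true_and, uncrossed] at hx hz
    rcases hx.2.2 with hx | hx
    · exact hz.2.2 hx
    · have := (mem_middle.1 hx.1).1
      omega
  have hs : (uncrossed k τ ∪ V.image fun z => (b, z)) ∪
      (({(a, b)} : Finset (Fin n × Fin n)).filter
      fun _ => a ∈ middle n k ∧ b ∈ middle n k) ⊆ uncrossed k ρ ∪ U.image fun z => (a, z) := by
    rintro ⟨x, y⟩ hx
    simp only [mem_union, mem_filter, mem_singleton, mem_image, Prod.mk.injEq] at hx
    rcases hx with (hx | ⟨z, hz, rfl, rfl⟩) | ⟨⟨rfl, rfl⟩, hM⟩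
    · simp only [uncrossed, mem_filter, mem_univ, true_and, Fin.lt_def, mem_union, mem_image,
        Prod.mk.injEq, hU, inner, mem_middle] at hx ⊢
      have hne := h.ne
      by_cases hxa : x = a
      · subst hxa
        by_cases hyb : y = b
        · subst hyb
          omega
        · have hyx : y ≠ x := by
            rintro rfl
            omega
          obtain ⟨h4, h5, h6⟩ := h.rest y hyx hyb
          rw [h6] at hx
          -- If `a` and `y` both start in the middle, the pair was counted before; otherwise it is
          -- accounted for by `U`.
          by_cases hM : (k ≤ (x : ℕ) ∧ (x : ℕ) + k < n) ∧ k ≤ (y : ℕ) ∧ (y : ℕ) + k < n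
          · left
            omega
          · right
            refine ⟨y, ?_, rfl, rfl⟩
            omega
      · left
        by_cases hxb : x = b
        · subst hxb
          have hya : y ≠ a := by
            rintro rfl
            omega
          have hyx : y ≠ x := by
            rintro rfl
            omega
          obtain ⟨h4, h5, h6⟩ := h.rest y hya hyx
          rw [h6] at hx
          omega
        · obtain ⟨h4, h5, h6⟩ := h.rest x hxa hxb
          rw [h6] at hx
          by_cases hya : y = a
          · subst hya
            omega
          · by_cases hyb : y = b
            · subst hyb
              omega
            · obtain ⟨h7, h8, h9⟩ := h.rest y hya hyb
              rw [h9] at hx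
              exact hx
    · simp only [hV, inner, mem_filter, mem_univ, true_and, mem_middle] at hz
      simp only [uncrossed, mem_filter, mem_univ, true_and, Fin.lt_def, mem_union, mem_middle]
      left
      have := hz.2.1
      rw [Fin.lt_def] at this
      omega
    · simp only [uncrossed, mem_filter, mem_univ, true_and, Fin.lt_def, mem_union, hM, hl0, hr0]
      left
      rw [Fin.lt_def] at hab
      simp [hab]
  have := card_le_card hs
  rw [card_union_of_disjoint hd, card_union_of_disjoint hd', h1, h3] at this
  have := card_union_le (uncrossed k ρ) (U.image fun z => (a, z))
  omega

/-- The change of the potential, by cases on where `a < b` start. The factor `ε` switches the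
contribution of `common` off before its minimum is reached and on afterwards. -/
theorem step_of_left {n k p s : ℕ} (hkn : 2 * k < n) {ρ τ : Equiv.Perm (Fin n)}
    {a b : Fin n} (h : Exchange p ρ τ a b) (hp : p + 1 = k) (hab : a < b)
    (hs : s ≤ (common k ρ).card) (hs' : s ≤ (common k τ).card) {ε : ℤ} (hε : ε = 0 ∨ ε = 1) :
    2 * ((uncrossed k τ).card : ℤ) +
      ε * (((common k τ).card - s : ℤ) * ((common k τ).card - s - 1) -
        ((common k ρ).card - s : ℤ) * ((common k ρ).card - s - 1)) ≤
    2 * ((uncrossed k ρ).card : ℤ) + 2 * (n - 2 * k - 1 - s) +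
      2 * s * ((moved k τ : ℤ) - moved k ρ) ∧
    (moved k τ : ℤ) - moved k ρ + ε * ((common k τ).card - (common k ρ).card) ≤ 1 := by
  have h1 := card_uncrossed_of_left hkn h hp hab
  obtain ⟨h2, h3⟩ := card_common_of_left hkn h hp
  have h4 := moved_of_left hkn h hp
  have h5 : ((inner k ρ).card : ℤ) = n - 2 * k - 1 := by
    rw [card_inner]
    omega
  have h6 := card_inter_add_card_sdiff (inner k ρ) (middle n k)
  set U := (inner k ρ).filter fun z => a < z ∧ ¬(a ∈ middle n k ∧ z ∈ middle n k) with hU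
  set V := (inner k ρ).filter fun z => b < z ∧ ¬(b ∈ middle n k ∧ z ∈ middle n k) with hV
  have h7 : U.card ≤ (inner k ρ).card := card_le_card (filter_subset _ _)
  -- If `z` in `U` starts in the middle, then `a < z` and `a` does not start there, so `a` starts
  -- among the first `k`. By hypothesis so does `b`, hence `b < z` and `z` lies in `V`.
  have h8 : ((a : ℕ) < k → (b : ℕ) < k) → U.card ≤ V.card + (inner k ρ \ middle n k).card := by
    intro hL
    refine le_trans (card_le_card ?_) (card_union_le _ _)
    intro z hz
    simp only [hU, hV, mem_filter, mem_union, mem_sdiff, mem_middle, Fin.lt_def] at hz ⊢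
    by_cases hzM : k ≤ (z : ℕ) ∧ (z : ℕ) + k < n
    · left
      refine ⟨hz.1, ?_⟩
      omega
    · right
      exact ⟨hz.1, hzM⟩
  have ha : a ∈ middle n k ↔ k ≤ (a : ℕ) ∧ (a : ℕ) + k < n := mem_middle
  have hb : b ∈ middle n k ↔ k ≤ (b : ℕ) ∧ (b : ℕ) + k < n := mem_middle
  rw [Fin.lt_def] at hab
  generalize (uncrossed k τ).card = P' at *
  generalize (uncrossed k ρ).card = P at *
  generalize (common k τ).card = c' at *
  generalize (common k ρ).card = c at *
  generalize moved k τ = X' at *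
  generalize moved k ρ = X at *
  generalize U.card = u at *
  generalize V.card = v at *
  generalize (inner k ρ).card = m at *
  generalize (inner k ρ ∩ middle n k).card = q at *
  generalize (inner k ρ \ middle n k).card = r at *
  by_cases haL : (a : ℕ) < k
  · have haM : a ∉ middle n k := fun e => absurd (ha.1 e).1 (by omega)
    simp only [haL, haM, if_true, if_false, false_and] at h1 h3 h4
    by_cases hbL : (b : ℕ) < k
    · have hbM : b ∉ middle n k := fun e => absurd (hb.1 e).1 (by omega)
      simp only [hbL, hbM, if_true, if_false] at h2 h4
      have h9 := h8 fun _ => hbL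
      have e1 : c' = c := by omega
      have e2 : X' = X := by omega
      subst e1 e2
      constructor
      · simp only [sub_self, mul_zero, add_zero]
        omega
      · simp
    · simp only [hbL, if_false] at h4
      have e2 : (X' : ℤ) - X = 1 := by omega
      rw [e2]
      -- As `moved` grows by one, the term `2 * s` cancels the saving, and the trivial bound on `U`
      -- suffices. The quadratic term does not grow, because `common` does not.
      have e4 : (P' : ℤ) ≤ P + (n - 2 * k - 1) := by omega
      by_cases hbM : b ∈ middle n k
      · simp only [hbM, if_true] at h2
        have e3 : (c : ℤ) = c' + 1 := by omega
        rw [e3]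
        have e5 : (s : ℤ) ≤ c' := by exact_mod_cast hs'
        rcases hε with rfl | rfl <;> constructor <;> linarith
      · simp only [hbM, if_false] at h2
        have e3 : (c : ℤ) = c' := by omega
        rw [e3]
        constructor <;> linarith
  · have h9 := h8 fun h => absurd h haL
    have hbL : ¬ (b : ℕ) < k := by omega
    simp only [haL, hbL, if_false] at h4
    have e2 : (X' : ℤ) - X = 0 := by omega
    rw [e2]
    by_cases haM : a ∈ middle n k
    · by_cases hbM : b ∈ middle n k
      · simp only [haM, hbM, if_true, and_self] at h1 h2 h3
        have e3 : (c : ℤ) = c' := by omega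
        rw [e3]
        constructor
        · simp only [sub_self, mul_zero, add_zero]
          omega
        · simp
      · simp only [haM, hbM, if_true, if_false, and_false] at h1 h2 h3
        have e3 : (c' : ℤ) = c + 1 := by omega
        rw [e3]
        -- The case that determines the quadratic term: when `c` rises to `c + 1`, the term grows by
        -- `2 * (c - s)`, exactly the saving beyond `s`.
        have e4 : (P' : ℤ) ≤ P + (n - 2 * k - 1) - c := by omega
        have e5 : (s : ℤ) ≤ c := by exact_mod_cast hs
        rcases hε with rfl | rfl <;> constructor <;> linarith
    · have hbM : b ∉ middle n k := fun e => haM (ha.2 ⟨by omega, by have := (hb.1 e).2; omega⟩)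
      simp only [haM, hbM, if_false, and_false] at h1 h2 h3
      have e3 : (c : ℤ) = c' := by omega
      rw [e3]
      constructor
      · simp only [sub_self, mul_zero, add_zero]
        omega
      · simp

/-- The mirror image of `step_of_left`: reflection reverses both labels and positions, so the pair
is again exchanged out of its initial order. -/
theorem step_of_right {n k p s : ℕ} (hkn : 2 * k < n) {ρ τ : Equiv.Perm (Fin n)}
    {a b : Fin n} (h : Exchange p ρ τ a b) (hp : p + 1 + k = n) (hab : a < b)
    (hs : s ≤ (common k ρ).card) (hs' : s ≤ (common k τ).card) {ε : ℤ} (hε : ε = 0 ∨ ε = 1) :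
    2 * ((uncrossed k τ).card : ℤ) +
      ε * (((common k τ).card - s : ℤ) * ((common k τ).card - s - 1) -
        ((common k ρ).card - s : ℤ) * ((common k ρ).card - s - 1)) ≤
    2 * ((uncrossed k ρ).card : ℤ) + 2 * (n - 2 * k - 1 - s) +
      2 * s * ((moved k τ : ℤ) - moved k ρ) ∧
    (moved k τ : ℤ) - moved k ρ + ε * ((common k τ).card - (common k ρ).card) ≤ 1 := by
  have hb := (ρ b).isLt
  rw [h.right] at hb
  have key := step_of_left (s := s) hkn h.flip (by omega) (Fin.rev_lt_rev.2 hab)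
    (by rwa [card_common_flip]) (by rwa [card_common_flip]) hε
  simpa only [card_common_flip, card_uncrossed_flip, moved_flip] using key

/-- Away from the two boundaries the set of elements in the middle is unchanged. As `a < b`, no pair
regains its initial order, and a central exchange loses the pair `(a, b)`. -/
theorem invariant_of_noncritical {n k p : ℕ} {ρ τ : Equiv.Perm (Fin n)}
    {a b : Fin n} (h : Exchange p ρ τ a b) (hp : p + 1 ≠ k) (hp' : p + 1 + k ≠ n) (hab : a < b) :
    (uncrossed k τ).card + (if k ≤ p ∧ p + 1 + k < n then 1 else 0) ≤ (uncrossed k ρ).card ∧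
      common k τ = common k ρ ∧ moved k τ = moved k ρ := by
  have hl := h.left'
  have hr := h.right'
  have hl0 := h.left
  have hr0 := h.right
  have hk : ∀ x, k ≤ (τ x : ℕ) ↔ k ≤ (ρ x : ℕ) := by
    intro x
    by_cases hxa : x = a
    · subst hxa
      omega
    by_cases hxb : x = b
    · subst hxb
      omega
    rw [(h.rest x hxa hxb).2.2]
  have hk' : ∀ x, (τ x : ℕ) + k < n ↔ (ρ x : ℕ) + k < n := by
    intro x
    by_cases hxa : x = a
    · subst hxa
      omega
    by_cases hxb : x = b
    · subst hxb
      omega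
    rw [(h.rest x hxa hxb).2.2]
  refine ⟨?_, by simp only [common, mem_middle, hk, hk'],
    by simp only [moved, movedLeft, movedRight, hk, hk']⟩
  have hsub : uncrossed k τ ⊆ uncrossed k ρ := by
    rintro ⟨x, y⟩ hx
    simp only [uncrossed, mem_filter, mem_univ, true_and, mem_middle, hk, hk'] at hx ⊢
    refine ⟨hx.1, ?_, hx.2.2⟩
    have h1 := hx.1
    have h2 := hx.2.1
    rw [Fin.lt_def] at h1 h2 hab ⊢
    by_cases hxa : x = a
    · subst hxa
      by_cases hyb : y = b
      · subst hyb
        omega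
      · have hyx : y ≠ x := by
          rintro rfl
          omega
        obtain ⟨h4, h5, h6⟩ := h.rest y hyx hyb
        rw [h6] at h2
        omega
    · by_cases hxb : x = b
      · subst hxb
        have hya : y ≠ a := by
          rintro rfl
          omega
        have hyx : y ≠ x := by
          rintro rfl
          omega
        obtain ⟨h4, h5, h6⟩ := h.rest y hya hyx
        rw [h6] at h2
        omega
      · obtain ⟨h4, h5, h6⟩ := h.rest x hxa hxb
        rw [h6] at h2
        by_cases hya : y = a
        · subst hya
          omega
        · by_cases hyb : y = b
          · subst hyb
            omega
          · obtain ⟨h7, h8, h9⟩ := h.rest y hya hyb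
            rwa [h9] at h2
  split_ifs with hc
  · refine card_lt_card ((ssubset_iff_of_subset hsub).2 ⟨(a, b), ?_, ?_⟩)
    · simp only [uncrossed, mem_filter, mem_univ, true_and, mem_middle, Fin.lt_def]
      rw [Fin.lt_def] at hab
      omega
    · simp only [uncrossed, mem_filter, mem_univ, true_and, Fin.lt_def]
      omega
  · exact card_le_card hsub

/-! ### Every exchange reverses a pair for the first time -/

/-- The pairs of elements that are in the same order under `ρ` as initially. -/
def ordered {n : ℕ} (ρ : Equiv.Perm (Fin n)) : Finset (Fin n × Fin n) :=
  univ.filter fun q => q.1 < q.2 ∧ ρ q.1 < ρ q.2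

/-- An exchange decreases the number of pairs in their initial order by at most one, and does not
decrease it if the exchanged pair is not in its initial order. -/
theorem card_ordered_le {n p : ℕ} {ρ τ : Equiv.Perm (Fin n)}
    {a b : Fin n} (h : Exchange p ρ τ a b) :
    (ordered ρ).card ≤ (ordered τ).card + (if a < b then 1 else 0) := by
  have hl := h.left'
  have hr := h.right'
  have hl0 := h.left
  have hr0 := h.right
  have hsub : ordered ρ ⊆ ordered τ ∪
      (({(a, b)} : Finset (Fin n × Fin n)).filter fun _ => a < b) := by
    rintro ⟨x, y⟩ hx
    simp only [ordered, mem_filter, mem_univ, true_and, mem_union, mem_singleton, Prod.mk.injEq]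
      at hx ⊢
    by_cases hxy : x = a ∧ y = b
    · right
      refine ⟨hxy, ?_⟩
      rw [← hxy.1, ← hxy.2]
      exact hx.1
    left
    refine ⟨hx.1, ?_⟩
    have h2 := hx.2
    rw [Fin.lt_def] at h2 ⊢
    by_cases hxa : x = a
    · subst hxa
      have hyb : y ≠ b := fun e => hxy ⟨rfl, e⟩
      have hyx : y ≠ x := by
        rintro rfl
        omega
      obtain ⟨h4, h5, h6⟩ := h.rest y hyx hyb
      rw [h6]
      omega
    · by_cases hxb : x = b
      · subst hxb
        have hyx : y ≠ x := by
          rintro rfl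
          omega
        by_cases hya : y = a
        · subst hya
          omega
        obtain ⟨h4, h5, h6⟩ := h.rest y hya hyx
        rw [h6]
        omega
      · obtain ⟨h4, h5, h6⟩ := h.rest x hxa hxb
        rw [h6]
        by_cases hya : y = a
        · subst hya
          omega
        · by_cases hyb : y = b
          · subst hyb
            omega
          · obtain ⟨h7, h8, h9⟩ := h.rest y hya hyb
            rwa [h9]
  refine le_trans (card_le_card hsub) (le_trans (card_union_le _ _) ?_)
  split_ifs with hab <;> simp [hab]

theorem two_mul_card_filter_lt {n : ℕ} (A : Finset (Fin n)) :
    2 * ((A ×ˢ A).filter fun q => q.1 < q.2).card = A.card * A.card - A.card := by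
  rw [← offDiag_card, two_mul]
  have h1 : ((A ×ˢ A).filter fun q => q.1 < q.2).card =
      ((A ×ˢ A).filter fun q => q.2 < q.1).card := by
    refine card_bij' (fun q _ => q.swap) (fun q _ => q.swap) ?_ ?_ (by simp) (by simp)
    all_goals
      rintro ⟨x, y⟩
      simp only [mem_filter, mem_product, Prod.swap_prod_mk]
      tauto
  nth_rewrite 2 [h1]
  rw [← card_union_of_disjoint]
  · congr 1
    ext ⟨x, y⟩
    simp only [mem_union, mem_filter, mem_product, mem_offDiag, ne_iff_lt_or_gt]
    tauto
  · rw [disjoint_filter]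
    intro q _ h h'
    exact absurd h h'.asymm

theorem card_ordered_one (n : ℕ) : (ordered (1 : Equiv.Perm (Fin n))).card = n.choose 2 := by
  have h := two_mul_card_filter_lt (univ : Finset (Fin n))
  have e : ordered (1 : Equiv.Perm (Fin n)) =
      ((univ : Finset (Fin n)) ×ˢ univ).filter fun q => q.1 < q.2 := by
    ext q
    simp [ordered]
  rw [← e, card_univ, Fintype.card_fin] at h
  rw [Nat.choose_two_right, Nat.mul_sub_one, ← h]
  omega

theorem card_ordered_revPerm (n : ℕ) : (ordered (Fin.revPerm : Equiv.Perm (Fin n))).card = 0 := by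
  rw [card_eq_zero, eq_empty_iff_forall_notMem]
  rintro ⟨x, y⟩ h
  simp only [ordered, mem_filter, mem_univ, true_and, Fin.revPerm_apply, Fin.rev_lt_rev] at h
  exact absurd h.1 h.2.asymm

/-- In a sequence of `n.choose 2` exchanges that reverses the order of all the elements, every
exchanged pair is in its initial order. -/
theorem exchange_lt {n : ℕ} {ρ : ℕ → Equiv.Perm (Fin n)} {p : ℕ → ℕ} {a b : ℕ → Fin n}
    (hex : ∀ t, Exchange (p t) (ρ t) (ρ (t + 1)) (a t) (b t)) (h0 : ρ 0 = 1)
    (hN : ρ (n.choose 2) = Fin.revPerm) {t : ℕ} (ht : t < n.choose 2) : a t < b t := by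
  by_contra hab
  have h1 : ∀ m, (ordered (ρ 0)).card ≤
      (ordered (ρ m)).card + ∑ i ∈ range m, (if a i < b i then 1 else 0) := by
    intro m
    induction m with
    | zero => simp
    | succ m ih =>
      rw [sum_range_succ]
      have := card_ordered_le (hex m)
      omega
  have h2 := h1 (n.choose 2)
  rw [hN, h0, card_ordered_one, card_ordered_revPerm, zero_add, ← card_filter] at h2
  -- A single exchange with `a t ≥ b t` would leave too few exchanges to reverse all `n.choose 2`
  -- pairs.
  have h3 : ((range (n.choose 2)).filter fun i => a i < b i) ⊂ range (n.choose 2) :=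
    (ssubset_iff_of_subset (filter_subset _ _)).2 ⟨t, mem_range.2 ht, by simp [hab]⟩
  have h4 := card_lt_card h3
  rw [card_range] at h4
  omega

/-! ### Boundary values and summation over the halfperiod -/

theorem card_uncrossed_one_le {n k : ℕ} :
    2 * (uncrossed k (1 : Equiv.Perm (Fin n))).card ≤ (n - 2 * k) * (n - 2 * k) - (n - 2 * k) := by
  rw [← card_middle, ← two_mul_card_filter_lt]
  refine Nat.mul_le_mul_left 2 (card_le_card ?_)
  rintro ⟨x, y⟩ h
  simp only [uncrossed, mem_filter, mem_univ, true_and, mem_product] at h ⊢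
  simp only [Equiv.Perm.one_apply] at h
  tauto

theorem moved_one {n k : ℕ} : moved k (1 : Equiv.Perm (Fin n)) = 0 := by
  rw [moved, Nat.add_eq_zero_iff, card_eq_zero, card_eq_zero, eq_empty_iff_forall_notMem,
    eq_empty_iff_forall_notMem]
  constructor
  all_goals
    intro x h
    simp only [movedLeft, movedRight, mem_filter, mem_univ, true_and] at h
    rw [Equiv.Perm.one_apply] at h
    omega

theorem moved_revPerm {n k : ℕ} (hkn : 2 * k < n) :
    moved k (Fin.revPerm : Equiv.Perm (Fin n)) = 2 * k := by
  have h1 : (movedLeft k (Fin.revPerm : Equiv.Perm (Fin n))).map Fin.valEmbedding = range k := by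
    ext x
    simp only [mem_map, movedLeft, mem_filter, mem_univ, true_and, Fin.valEmbedding_apply,
      mem_range, Fin.revPerm_apply, Fin.val_rev]
    constructor
    · rintro ⟨a, h, rfl⟩
      omega
    · intro h
      exact ⟨⟨x, by omega⟩, ⟨h, by simp only; omega⟩, rfl⟩
  have h2 : (movedRight k (Fin.revPerm : Equiv.Perm (Fin n))).map Fin.valEmbedding =
      Ico (n - k) n := by
    ext x
    simp only [mem_map, movedRight, mem_filter, mem_univ, true_and, Fin.valEmbedding_apply,
      mem_Ico, Fin.revPerm_apply, Fin.val_rev]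
    constructor
    · rintro ⟨a, h, rfl⟩
      omega
    · intro h
      exact ⟨⟨x, h.2⟩, ⟨by simp only; omega, by simp only; omega⟩, rfl⟩
  rw [moved, ← card_map Fin.valEmbedding, h1, ← card_map Fin.valEmbedding, h2, card_range,
    Nat.card_Ico]
  omega

theorem card_common_revPerm {n k : ℕ} :
    (common k (Fin.revPerm : Equiv.Perm (Fin n))).card = n - 2 * k := by
  rw [← card_middle]
  congr 1
  ext x
  simp [common, rev_mem_middle]

theorem card_central_le {n k s : ℕ} (hkn : 2 * k < n) {ρ : ℕ → Equiv.Perm (Fin n)} {p : ℕ → ℕ}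
    (hex : ∀ t, ∃ a b, Exchange (p t) (ρ t) (ρ (t + 1)) a b) (h0 : ρ 0 = 1)
    (hN : ρ (n.choose 2) = Fin.revPerm) (hs : ∀ t ≤ n.choose 2, s ≤ (common k (ρ t)).card)
    (hs' : ∃ t ≤ n.choose 2, (common k (ρ t)).card = s) :
    2 * (((range (n.choose 2)).filter fun t => k ≤ p t ∧ p t + 1 + k < n).card : ℤ) ≤
      (n - 2 * k : ℤ) * (n - 2 * k - 1) - (n - 2 * k - s) * (n - 2 * k - s - 1) + 4 * k * s +
        2 * (n - 2 * k - 1 - s) *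
          ((range (n.choose 2)).filter fun t => p t + 1 = k ∨ p t + 1 + k = n).card ∧
    (n - s : ℤ) ≤ ((range (n.choose 2)).filter fun t => p t + 1 = k ∨ p t + 1 + k = n).card := by
  obtain ⟨t₀, ht₀, hc₀⟩ := hs'
  choose a b hex using hex
  have hlt := fun t (ht : t < n.choose 2) => exchange_lt hex h0 hN ht
  -- Freezing `c` at `s` before `t₀` discards the initial descent of `common` from `n - 2k`, which
  -- would otherwise cancel the gain of the later climb.
  let c : ℕ → ℤ := fun t => if t₀ ≤ t then ((common k (ρ t)).card : ℤ) else s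
  let f : ℕ → ℤ := fun t => 2 * ((uncrossed k (ρ t)).card : ℤ) +
    (c t - s) * (c t - s - 1) - 2 * s * moved k (ρ t)
  have hstep : ∀ t < n.choose 2,
      2 * (if k ≤ p t ∧ p t + 1 + k < n then 1 else 0 : ℤ) + f (t + 1) ≤
        f t + 2 * (n - 2 * k - 1 - s) * (if p t + 1 = k ∨ p t + 1 + k = n then 1 else 0 : ℤ) ∧
      moved k (ρ (t + 1)) + c (t + 1) ≤
        moved k (ρ t) + c t + (if p t + 1 = k ∨ p t + 1 + k = n then 1 else 0 : ℤ) := by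
    intro t ht
    have hε : ∃ ε : ℤ, (ε = 0 ∨ ε = 1) ∧
        c (t + 1) - c t = ε * ((common k (ρ (t + 1))).card - (common k (ρ t)).card) ∧
        (c (t + 1) - s) * (c (t + 1) - s - 1) - (c t - s) * (c t - s - 1) =
          ε * (((common k (ρ (t + 1))).card - s : ℤ) * ((common k (ρ (t + 1))).card - s - 1) -
          ((common k (ρ t)).card - s : ℤ) * ((common k (ρ t)).card - s - 1)) := by
      rcases lt_trichotomy (t + 1) t₀ with h | h | h
      · refine ⟨0, Or.inl rfl, ?_⟩
        simp only [c, if_neg (show ¬ t₀ ≤ t by omega), if_neg (show ¬ t₀ ≤ t + 1 by omega)]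
        simp
      -- There is no jump on arrival at `t₀`, since `common` has size `s` there.
      · refine ⟨0, Or.inl rfl, ?_⟩
        simp only [c, if_neg (show ¬ t₀ ≤ t by omega), h, hc₀]
        simp
      · refine ⟨1, Or.inr rfl, ?_⟩
        simp only [c, if_pos (show t₀ ≤ t by omega), if_pos (show t₀ ≤ t + 1 by omega)]
        simp
    obtain ⟨ε, hε, h1, h2⟩ := hε
    simp only [f]
    by_cases hcrit : p t + 1 = k ∨ p t + 1 + k = n
    · have hnc : ¬ (k ≤ p t ∧ p t + 1 + k < n) := by omega
      rw [if_pos hcrit, if_neg hnc]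
      have key := hcrit.elim
        (fun hp => step_of_left hkn (hex t) hp (hlt t ht) (hs t ht.le) (hs (t + 1) ht) hε)
        (fun hp => step_of_right hkn (hex t) hp (hlt t ht) (hs t ht.le) (hs (t + 1) ht) hε)
      rw [← h1, ← h2] at key
      constructor <;> linarith [key.1, key.2]
    · obtain ⟨h3, h4, h5⟩ := invariant_of_noncritical (k := k) (hex t) (fun h => hcrit (Or.inl h))
        (fun h => hcrit (Or.inr h)) (hlt t ht)
      rw [h4, sub_self, mul_zero] at h1 h2
      rw [if_neg hcrit, h5]
      have h6 : (if k ≤ p t ∧ p t + 1 + k < n then 1 else 0 : ℤ) +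
          (uncrossed k (ρ (t + 1))).card ≤ (uncrossed k (ρ t)).card := by
        split_ifs at h3 ⊢ <;> omega
      constructor <;> linarith
  have hsum : ∀ m ≤ n.choose 2,
      2 * (((range m).filter fun t => k ≤ p t ∧ p t + 1 + k < n).card : ℤ) + f m ≤
        f 0 + 2 * (n - 2 * k - 1 - s) *
          ((range m).filter fun t => p t + 1 = k ∨ p t + 1 + k = n).card ∧
      moved k (ρ m) + c m ≤ moved k (ρ 0) + c 0 +
        ((range m).filter fun t => p t + 1 = k ∨ p t + 1 + k = n).card := by
    intro m hm
    simp only [card_filter, Nat.cast_sum, Nat.cast_ite, Nat.cast_one, Nat.cast_zero]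
    induction m with
    | zero => simp
    | succ m ih =>
      obtain ⟨h1, h2⟩ := hstep m (by omega)
      obtain ⟨h3, h4⟩ := ih (by omega)
      rw [sum_range_succ, sum_range_succ, mul_add, mul_add]
      constructor <;> linarith
  obtain ⟨h1, h2⟩ := hsum _ le_rfl
  have hcN : c (n.choose 2) = n - 2 * k := by
    simp only [c, if_pos ht₀, hN, card_common_revPerm]
    omega
  have hc0 : c 0 = s := by
    simp only [c]
    split_ifs with h
    · rw [← hc₀, Nat.le_zero.1 h]
    · rfl
  have hu : 2 * ((uncrossed k (1 : Equiv.Perm (Fin n))).card : ℤ) ≤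
      (n - 2 * k : ℤ) * (n - 2 * k - 1) := by
    have h := card_uncrossed_one_le (n := n) (k := k)
    obtain ⟨K, hK⟩ : ∃ K, n = 2 * k + K := ⟨n - 2 * k, by omega⟩
    rw [show n - 2 * k = K by omega] at h
    have h' : 2 * (uncrossed k (1 : Equiv.Perm (Fin n))).card + K ≤ K * K := by
      have := Nat.le_mul_self K
      omega
    have e : (n : ℤ) = 2 * k + K := by exact_mod_cast hK
    zify at h'
    rw [e]
    linarith
  simp only [f, hcN, hc0, hN, h0, moved_one, moved_revPerm hkn, Nat.cast_zero] at h1 h2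
  -- The final potential is bounded below by dropping its `uncrossed` term.
  have hun : (0 : ℤ) ≤ ((uncrossed k (Fin.revPerm : Equiv.Perm (Fin n))).card : ℤ) := by positivity
  push_cast at h1 h2
  constructor <;> linarith

/-! ### Translation to allowable sequences -/

theorem isTransposition_mul_swap_iff {n p i : ℕ} (σ : Equiv.Perm (Fin n)) (h : p + 1 < n) :
    IsTransposition i σ (σ * Equiv.swap (⟨p, Nat.lt_of_succ_lt h⟩ : Fin n) ⟨p + 1, h⟩) ↔
      p + 1 = i := by
  constructor
  · rintro ⟨h1, h2, h3⟩
    have h4 := congrArg (fun e : Equiv.Perm (Fin n) => (e ⟨p, Nat.lt_of_succ_lt h⟩ : ℕ))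
      (mul_left_cancel h3)
    simp only [Equiv.swap_apply_left] at h4
    rw [Equiv.swap_apply_def] at h4
    simp only [Fin.mk.injEq] at h4
    split_ifs at h4 <;> simp only at h4 <;> omega
  · rintro rfl
    exact ⟨by omega, h, rfl⟩

theorem exists_isCritical_eq_iff {n k p : ℕ} (hk : 1 ≤ k) (hkn : 2 * k < n)
    (σ : Equiv.Perm (Fin n)) (h : p + 1 < n) :
    (∃ m, m = k - 1 + 1 ∧
      IsCritical m σ (σ * Equiv.swap (⟨p, Nat.lt_of_succ_lt h⟩ : Fin n) ⟨p + 1, h⟩)) ↔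
      p + 1 = k ∨ p + 1 + k = n := by
  simp only [IsCritical, isTransposition_mul_swap_iff, exists_eq_left]
  omega

theorem exists_isCritical_ge_iff {n k p : ℕ} (σ : Equiv.Perm (Fin n)) (h : p + 1 < n) :
    (∃ m, k + 1 ≤ m ∧
      IsCritical m σ (σ * Equiv.swap (⟨p, Nat.lt_of_succ_lt h⟩ : Fin n) ⟨p + 1, h⟩)) ↔
      k ≤ p ∧ p + 1 + k < n := by
  simp only [IsCritical, isTransposition_mul_swap_iff]
  constructor
  · rintro ⟨m, hm⟩
    omega
  · intro hp
    -- A `(p + 1)`-transposition is critical for the distance of the gap from the nearer end.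
    exact ⟨min (p + 1) (n - (p + 1)), by omega⟩

theorem countCritical_eq_card {n : ℕ} {Q : ℕ → Prop} {π : PermSeq n} (R : ℕ → Prop)
    [DecidablePred R]
    (h : ∀ i : Fin (n.choose 2), (∃ m, Q m ∧ IsCritical m (π i.castSucc) (π i.succ)) ↔ R i) :
    countCritical Q π = ((range (n.choose 2)).filter R).card := by
  unfold countCritical
  rw [card_filter, card_filter, sum_range]
  simp only [h]

/-- The permutation `τ⁻¹ * σ` sends the position of an element in `σ` to its position in `τ`, so `σ`
maps `common` onto the intersection of the centers. -/
theorem card_kCenter_inter {n k : ℕ} (σ τ : Equiv.Perm (Fin n)) :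
    (kCenter k σ ∩ kCenter k τ).card = (common k (τ⁻¹ * σ)).card := by
  rw [← card_image_of_injective (common k (τ⁻¹ * σ)) σ.injective]
  congr 1
  ext x
  simp only [mem_inter, kCenter, mem_image, common, mem_filter, mem_univ, true_and, mem_middle,
    Equiv.Perm.mul_apply]
  constructor
  · rintro ⟨⟨y, hy, rfl⟩, z, hz, hzy⟩
    refine ⟨y, ⟨hy, ?_⟩, rfl⟩
    rw [← hzy]
    simpa using hz
  · rintro ⟨y, ⟨hy, hz⟩, rfl⟩
    exact ⟨⟨y, hy, rfl⟩, _, hz, by simp⟩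

end AllowableSequence

open AllowableSequence in
theorem mainTheorem1 (n k : ℕ) (hk : 1 ≤ k) (hkn : 2 * k < n)
    (S : SimpleAllowableSequence n)
    (π : AllowableSequence.PermSeq n) (hπ : AllowableSequence.IsHalfperiod S π)
    (s : ℕ) (hs : s = AllowableSequence.minCenter k π) :
    (AllowableSequence.numEdgesGE k S : ℝ) ≤
      ((n : ℝ) - 2 * (k : ℝ) - 1) * (AllowableSequence.numEdges (k - 1) S : ℝ)
        - (s : ℝ) / 2 * ((AllowableSequence.numEdges (k - 1) S : ℝ) - (n : ℝ) + 1) := by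
  rw [numEdgesGE_eq k S hπ, numEdges_eq (k - 1) S hπ]
  obtain ⟨a, ha⟩ := hπ
  choose p hp hstep using fun t : ℕ => S.step (a + t)
  -- Passing to inverses turns transpositions of positions, which act on the right of `S.perm`, into
  -- left multiplications, and makes the initial order the identity.
  let ρ : ℕ → Equiv.Perm (Fin n) := fun t => (S.perm (a + t))⁻¹ * S.perm a
  have hρ : ∀ i, ρ ((i : Fin (n.choose 2 + 1)) : ℕ) = (π i)⁻¹ * π 0 := by
    intro i
    simp [ρ, ha]
  have hsucc : ∀ i : Fin (n.choose 2), π i.succ = π i.castSucc *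
      Equiv.swap (⟨p i, Nat.lt_of_succ_lt (hp i)⟩ : Fin n) ⟨p i + 1, hp i⟩ := by
    intro i
    rw [ha, ha, Fin.val_succ, Fin.val_castSucc, ← hstep, Nat.cast_succ, add_assoc]
  have hex : ∀ t, ∃ a b, Exchange (p t) (ρ t) (ρ (t + 1)) a b := by
    intro t
    have e : ρ (t + 1) =
        Equiv.swap (⟨p t, Nat.lt_of_succ_lt (hp t)⟩ : Fin n) ⟨p t + 1, hp t⟩ * ρ t := by
      simp only [ρ]
      rw [Nat.cast_succ, ← add_assoc, hstep, mul_inv_rev, Equiv.swap_inv, mul_assoc]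
    rw [e]
    exact exists_exchange (ρ t) (hp t)
  have h0 : ρ 0 = 1 := by simp [ρ]
  have hN : ρ (n.choose 2) = Fin.revPerm := by
    simp only [ρ]
    rw [S.reverse, mul_inv_rev, inv_mul_cancel_right]
    rfl
  have hmin : ∀ t ≤ n.choose 2, s ≤ (common k (ρ t)).card := by
    intro t ht
    have h := hρ ⟨t, by omega⟩
    simp only at h
    rw [h, ← card_kCenter_inter, hs]
    exact Finset.inf'_le _ (Finset.mem_univ _)
  have hmin' : ∃ t ≤ n.choose 2, (common k (ρ t)).card = s := by
    obtain ⟨i, -, hi⟩ := Finset.exists_mem_eq_inf' (Finset.univ_nonempty)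
      fun i => (kCenter k (π 0) ∩ kCenter k (π i)).card
    exact ⟨i, by omega, by rw [hρ, ← card_kCenter_inter, hs]; exact hi.symm⟩
  have hL := countCritical_eq_card (Q := fun m => k + 1 ≤ m) (π := π)
    (fun t => k ≤ p t ∧ p t + 1 + k < n) fun i => by
      rw [hsucc]
      exact exists_isCritical_ge_iff _ _
  have hE := countCritical_eq_card (Q := fun m => m = k - 1 + 1) (π := π)
    (fun t => p t + 1 = k ∨ p t + 1 + k = n) fun i => by
      rw [hsucc]
      exact exists_isCritical_eq_iff hk hkn _ _
  obtain ⟨h1, h2⟩ := card_central_le hkn hex h0 hN hmin hmin'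
  rw [← hE] at h1 h2
  rw [← hL] at h1
  generalize countCritical (fun m => k + 1 ≤ m) π = L at *
  generalize countCritical (fun m => m = k - 1 + 1) π = E at *
  -- Twice the claimed bound exceeds the bound `h4` on `2 * L` by exactly this quantity.
  have h3 : 0 ≤ (s : ℝ) * ((E : ℝ) - n + s) := by
    refine mul_nonneg (Nat.cast_nonneg s) ?_
    have : (n - s : ℝ) ≤ E := by exact_mod_cast h2
    linarith
  have h4 : 2 * (L : ℝ) ≤ (n - 2 * k : ℝ) * (n - 2 * k - 1) -
      (n - 2 * k - s) * (n - 2 * k - s - 1) + 4 * k * s + 2 * (n - 2 * k - 1 - s) * E := by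
    exact_mod_cast h1
  linarith
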